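/- All graphs are finite and simple. Let $\mathcal P$ be a principal ideal domain. For a graph $G=(V,E)$, let $L(G,X)$ be the $V\times V$ matrix over $\mathcal P[x_v : v\in V]$ with diagonal entries $x_v$, with entry $-1$ at $(u,v)$ if $u$ and $v$ are adjacent, and with all other entries $0$. The algebraic co-rank $\gamma_{\mathcal P}(G)$ is the largest $i\ge 0$ such that the determinants of the $i\times i$ submatrices of $L(G,X)$ generate the unit ideal (for $i=0$ this always holds). A cograph is a graph with no induced path on four vertices. For $\mathbf d\in\mathbb Z^{V}$ let $G^{\mathbf d}$ be the graph obtained from $G$ by duplicating the vertex $v$ $\mathbf d_v$ times if $\mathbf d_v>0$ and replicating it $-\mathbf d_v$ times if $\mathbf d_v<0$; that is, each vertex $v$ is replaced by $|\mathbf d_v|+1$ copies, pairwise adjacent if $\mathbf d_v<0$ and pairwise nonadjacent otherwise, and copies of distinct vertices are adjacent exactly when these vertices are adjacent in $G$. For $\delta\in\{0,1,-1\}^{V}$ let $\mathcal T_\delta(G)=\{G^{\mathbf d} : \mathbf d\in\mathbb Z^{V},\ \operatorname{sign}(\mathbf d_v)=\delta_v \text{ for all } v\in V\}$, and let $\mathcal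 T^*_\delta(G)$ be the class of all graphs isomorphic to an induced subgraph of a graph in $\mathcal T_\delta(G)$. Then for every integer $k\ge 1$ there is a finite set $\mathcal G$ of pairs $(G,\delta)$, with $G$ a graph and $\delta\in\{0,1,-1\}^{V(G)}$, such that a connected graph $C$ is a cograph with $\gamma_{\mathcal P}(C)\le k$ if and only if $$C\in\bigcup_{(G,\delta)\in\mathcal G}\mathcal T^*_\delta(G).$$ Moreover, every graph in this union, connected or not, is a cograph with algebraic co-rank at most $k$. -/

import Mathlib

open scoped SimpleGraph

noncomputable section

open scoped Classical in
/-- The generalized Laplacian matrix `L(G, X)` of a simple graph `G` over `P[X]`: the variable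
`x_u` at the diagonal position `u`, and minus the number of arcs from `u` to `v` at the
position `(u, v)` with `u ≠ v`. -/
def generalizedLaplacian (P : Type*) [CommRing P] {V : Type*} (G : SimpleGraph V) :
    Matrix V V (MvPolynomial V P) :=
  Matrix.of fun u v => if u = v then MvPolynomial.X u else if G.Adj u v then -1 else 0

/-- The `i`-th critical ideal: the ideal of `P[X]` generated by the determinants of the `i × i`
submatrices of the generalized Laplacian matrix (`i` distinct rows, `i` distinct columns; the
order in which these are listed only changes the sign of the determinant). For `i = 0` it is
the unit ideal, for `i > |V|` it is zero. -/
def criticalIdeal (P : Type*) [CommRing P] {V : Type*} (G : SimpleGraph V) (i : ℕ) :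
    Ideal (MvPolynomial V P) :=
  Ideal.span (Set.range fun rc : (Fin i ↪ V) × (Fin i ↪ V) =>
    ((generalizedLaplacian P G).submatrix rc.1 rc.2).det)

/-- The algebraic co-rank: the largest `i` such that the `i`-th critical ideal is trivial, that
is, the unit ideal (see `isGreatest_algebraicCorank`). -/
def algebraicCorank (P : Type*) [CommRing P] {V : Type*} (G : SimpleGraph V) : ℕ :=
  sSup {i : ℕ | criticalIdeal P G i = ⊤}

theorem isGreatest_algebraicCorank (P : Type*) [CommRing P] [Nontrivial P] {V : Type*} [Finite V]
    (G : SimpleGraph V) :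
    IsGreatest {i : ℕ | criticalIdeal P G i = ⊤} (algebraicCorank P G) := by
  have hb : BddAbove {i : ℕ | criticalIdeal P G i = ⊤} := by
    refine ⟨Nat.card V, fun i hi => ?_⟩
    by_contra hlt
    have hE : IsEmpty (Fin i ↪ V) := ⟨fun f => hlt (by
      simpa using Nat.card_le_card_of_injective f f.injective)⟩
    have h0 : criticalIdeal P G i = ⊥ := by
      simp [criticalIdeal, Set.range_eq_empty]
    exact bot_ne_top (h0.symm.trans hi)
  have hn : {i : ℕ | criticalIdeal P G i = ⊤}.Nonempty := by
    have : Nonempty (Fin 0 ↪ V) := ⟨Function.Embedding.ofIsEmpty⟩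
    exact ⟨0, by simp [criticalIdeal, Ideal.span_singleton_one]⟩
  exact ⟨Nat.sSup_mem hn hb, fun i hi => le_csSup hb hi⟩

/-- A cograph is a simple graph without induced path on four vertices. -/
def IsCograph {V : Type*} (G : SimpleGraph V) : Prop :=
  ¬ SimpleGraph.pathGraph 4 ⊴ G

/-- The graph `G^d`, for an integer vector `d`: every vertex `v` is duplicated `d v` times if
`d v > 0` and replicated `-d v` times if `d v < 0`. So `v` gives rise to the `|d v| + 1` vertices
`(v, 0), …, (v, |d v|)`, which are pairwise adjacent if `d v < 0` and pairwise nonadjacent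
otherwise, and copies of different vertices are adjacent exactly when these are adjacent
in `G`. -/
def twinGraph {V : Type*} (G : SimpleGraph V) (d : V → ℤ) :
    SimpleGraph (Σ v : V, Fin ((d v).natAbs + 1)) where
  Adj a b := G.Adj a.1 b.1 ∨ (a.1 = b.1 ∧ a ≠ b ∧ d a.1 < 0)
  symm := ⟨by
    rintro a b (h | ⟨h, hne, hd⟩)
    · exact Or.inl h.symm
    · exact Or.inr ⟨h.symm, hne.symm, h ▸ hd⟩⟩
  loopless := ⟨by
    rintro a (h | ⟨-, hne, -⟩)
    · exact G.irrefl h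
    · exact hne rfl⟩

/-- `C` belongs to `T*_δ(G)`: it is (isomorphic to) an induced subgraph of a graph of the family
`T_δ(G) = {G^d : supp d = δ}`, where `supp d` is the vector of the signs of the entries of `d`,
and `δ` is a `{0, 1, -1}`-vector. -/
def MemTwinFamilyStar {V W : Type*} (G : SimpleGraph V) (δ : V → SignType)
    (C : SimpleGraph W) : Prop :=
  ∃ d : V → ℤ, (∀ v, SignType.sign (d v) = δ v) ∧ C ⊴ twinGraph G d

end

/-!
Over a field, the rank of a matrix is the largest size of a nonzero minor. Hence `γ_P(G)` is the
least rank of `L(G, x)` over all points `x` with coordinates in a field over `P`: minors generating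
the unit ideal cannot vanish at a common point, and a proper ideal of minors is contained in a
maximal ideal, which provides such a point.

A square matrix of rank `r` whose off-diagonal entries are `0` or `-1` has at most `r + 2 ^ r`
distinct rows, since a row is determined by its entries in `r` spanning columns. Vertices `u ≠ w`
of `C` with equal rows in `L(C, x)` are twins: the `(u, w)` entry equals both `x_u` and `x_w`, so it
is `0` (nonadjacent twins) or `-1` (adjacent twins). One vertex from each class of equal rows
therefore induces a graph `G` on at most `r + 2 ^ r` vertices of which `C` is a twin extension of
some sign pattern `δ`. Every other graph of `T_δ(G)` has, at the same values, a Laplacian obtained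
from that of `G` by repeating rows and columns, so its co-rank is at most `r`. As `P₄` has no twins,
all these graphs are cographs if `C` is one.
-/

section Matrices

variable {K m n : Type*}

theorem row_eq_of_span_col_le [CommSemiring K] {ι : Type*} {A : Matrix m n K} {c : ι → n}
    (hc : Submodule.span K (Set.range A.col) ≤ Submodule.span K (Set.range (A.col ∘ c))) {u v : m}
    (h : ∀ j, A u (c j) = A v (c j)) : A.row u = A.row v := by
  have heq : Set.EqOn (LinearMap.proj u : (m → K) →ₗ[K] K) (LinearMap.proj v)
      (Submodule.span K (Set.range (A.col ∘ c))) :=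
    LinearMap.eqOn_span' (Set.forall_mem_range.2 h)
  exact funext fun j => heq (hc (Submodule.subset_span ⟨j, rfl⟩))

theorem apply_apply_eq_of_row_eq {A : Matrix n n K} (hA : A.IsSymm) {f : n → n}
    (hf : ∀ i, A.row (f i) = A.row i) (i j : n) : A (f i) (f j) = A i j :=
  calc A (f i) (f j) = A i (f j) := congrFun (hf i) (f j)
    _ = A (f j) i := hA.apply _ _
    _ = A j i := congrFun (hf j) i
    _ = A i j := hA.apply _ _

variable [Field K]

open Submodule Module in
theorem exists_embedding_linearIndependent_col [Fintype n] (A : Matrix m n K) :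
    ∃ c : Fin A.rank ↪ n, LinearIndependent K (A.col ∘ c) ∧
      span K (Set.range (A.col ∘ c)) = span K (Set.range A.col) := by
  have : FiniteDimensional K (span K (Set.range A.col)) :=
    FiniteDimensional.span_of_finite K (Set.finite_range _)
  rw [A.rank_eq_finrank_span_cols]
  obtain ⟨f, hf, hspan, hli⟩ := exists_fun_fin_finrank_span_eq K (Set.range A.col)
  choose c hc using hf
  obtain rfl : A.col ∘ c = f := funext hc
  exact ⟨⟨c, hli.injective.of_comp⟩, hli, hspan⟩

theorem le_rank_iff_exists_det_submatrix_ne_zero [Finite m] [Fintype n] {A : Matrix m n K} {i : ℕ} :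
    i ≤ A.rank ↔ ∃ (r : Fin i ↪ m) (c : Fin i ↪ n), (A.submatrix r c).det ≠ 0 := by
  cases nonempty_fintype m
  constructor
  · intro hi
    obtain ⟨c₀, hc₀, -⟩ := exists_embedding_linearIndependent_col A
    let c : Fin i ↪ n := (Fin.castLEEmb hi).trans c₀
    let B : Matrix (Fin i) m K := (A.submatrix id c).transpose
    have hB : LinearIndependent K B.row := hc₀.comp _ (Fin.castLE_injective hi)
    have hBrank : i = B.rank := by rw [hB.rank_matrix, Fintype.card_fin]
    obtain ⟨r₀, hr₀, -⟩ := exists_embedding_linearIndependent_col B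
    let r : Fin i ↪ m := (finCongr hBrank).toEmbedding.trans r₀
    have hr : LinearIndependent K (A.submatrix r c).row :=
      hr₀.comp _ (finCongr hBrank).injective
    exact ⟨r, c, ((Matrix.isUnit_iff_isUnit_det _).1
      (Matrix.linearIndependent_rows_iff_isUnit.1 hr)).ne_zero⟩
  · rintro ⟨r, c, hdet⟩
    calc i = (A.submatrix r c).rank := by rw [Matrix.rank_of_det_ne_zero hdet, Fintype.card_fin]
      _ ≤ A.rank := A.rank_submatrix_le r c

theorem ncard_range_row_le [Fintype n] (A : Matrix n n K) (S : Finset K)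
    (hA : ∀ i j, i ≠ j → A i j ∈ S) :
    (Set.range A.row).ncard ≤ A.rank + S.card ^ A.rank := by
  obtain ⟨c, -, hspan⟩ := exists_embedding_linearIndependent_col A
  have hbasis : (A.row '' Set.range c).ncard ≤ A.rank :=
    calc (A.row '' Set.range c).ncard ≤ (Set.range c).ncard := Set.ncard_image_le (Set.toFinite _)
      _ = A.rank := by
        rw [← Set.image_univ, Set.ncard_image_of_injective _ c.injective, Set.ncard_univ,
          Nat.card_fin]
  have hrest : (A.row '' (Set.range c)ᶜ).ncard ≤ S.card ^ A.rank := by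
    have hinj : Set.InjOn (fun (a : n → K) j => a (c j)) (A.row '' (Set.range c)ᶜ) := by
      rintro _ ⟨u, -, rfl⟩ _ ⟨v, -, rfl⟩ h
      exact row_eq_of_span_col_le hspan.ge (congrFun h)
    have hmaps : ∀ a ∈ A.row '' (Set.range c)ᶜ,
        (fun j => a (c j)) ∈ (Fintype.piFinset fun _ : Fin A.rank => S : Set (Fin A.rank → K)) := by
      rintro _ ⟨u, hu, rfl⟩
      exact Finset.mem_coe.2 (Fintype.mem_piFinset.2 fun j => hA u (c j) fun h => hu ⟨j, h.symm⟩)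
    calc (A.row '' (Set.range c)ᶜ).ncard ≤ _ :=
          Set.ncard_le_ncard_of_injOn _ hmaps hinj (Finset.finite_toSet _)
      _ = S.card ^ A.rank := by rw [Set.ncard_coe_finset, Fintype.card_piFinset_const]
  calc (Set.range A.row).ncard
      = (A.row '' Set.range c ∪ A.row '' (Set.range c)ᶜ).ncard := by
        rw [← Set.image_union, Set.union_compl_self, Set.image_univ]
    _ ≤ (A.row '' Set.range c).ncard + (A.row '' (Set.range c)ᶜ).ncard := Set.ncard_union_le _ _
    _ ≤ A.rank + S.card ^ A.rank := add_le_add hbasis hrest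

end Matrices

theorem exists_leftInverse_fin_ncard_range {α β : Type*} (f : α → β) (hf : (Set.range f).Finite) :
    ∃ (q : α → Fin (Set.range f).ncard) (s : Fin (Set.range f).ncard → α),
      Function.LeftInverse q s ∧ ∀ a, f (s (q a)) = f a := by
  have := hf.to_subtype
  let e : Set.range f ≃ Fin (Set.range f).ncard :=
    Finite.equivFinOfCardEq (Nat.card_coe_set_eq _)
  let s : Set.range f → α := Function.surjInv Set.rangeFactorization_surjective
  have hs : ∀ b, Set.rangeFactorization f (s b) = b := Function.surjInv_eq _
  refine ⟨e ∘ Set.rangeFactorization f, s ∘ e.symm, fun i => ?_, fun a => ?_⟩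
  · simp only [Function.comp_apply, hs, e.apply_symm_apply]
  · simp only [Function.comp_apply, e.symm_apply_apply]
    exact congrArg Subtype.val (hs _)

section Laplacian

open scoped Classical in
/-- The matrix `L(G, x)` with diagonal `x`, that is, the generalized Laplacian of `G` evaluated at
a point `x` with coordinates in an arbitrary ring. -/
noncomputable def laplacianAt {K V : Type*} [Ring K] (G : SimpleGraph V) (x : V → K) :
    Matrix V V K :=
  Matrix.diagonal x - G.adjMatrix K

variable {K V W : Type*} {G : SimpleGraph V}

section Entries

variable [Ring K] {x : V → K} {u w : V}

theorem laplacianAt_self (G : SimpleGraph V) (x : V → K) (u : V) : laplacianAt G x u u = x u := by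
  simp [laplacianAt]

theorem laplacianAt_of_adj (h : G.Adj u w) : laplacianAt G x u w = -1 := by
  simp [laplacianAt, h.ne, h]

theorem laplacianAt_of_not_adj (hne : u ≠ w) (h : ¬ G.Adj u w) : laplacianAt G x u w = 0 := by
  simp [laplacianAt, hne, h]

theorem laplacianAt_eq_zero_or_eq_neg_one (hne : u ≠ w) :
    laplacianAt G x u w = 0 ∨ laplacianAt G x u w = -1 :=
  (em (G.Adj u w)).symm.imp (laplacianAt_of_not_adj hne) laplacianAt_of_adj

theorem laplacianAt_apply_eq_of_adj_iff {H : SimpleGraph W} {y : W → K} {u' w' : W} (hne : u ≠ w)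
    (hne' : u' ≠ w') (h : G.Adj u w ↔ H.Adj u' w') :
    laplacianAt G x u w = laplacianAt H y u' w' := by
  by_cases hG : G.Adj u w
  · rw [laplacianAt_of_adj hG, laplacianAt_of_adj (h.1 hG)]
  · rw [laplacianAt_of_not_adj hne hG, laplacianAt_of_not_adj hne' (hG ∘ h.2)]

theorem laplacianAt_eq_neg_one_iff [Nontrivial K] (G : SimpleGraph V) (x : V → K) (hne : u ≠ w) :
    laplacianAt G x u w = -1 ↔ G.Adj u w := by
  by_cases h : G.Adj u w
  · simp [laplacianAt_of_adj h, h]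
  · simp [laplacianAt_of_not_adj hne h, h]

theorem isSymm_laplacianAt (G : SimpleGraph V) (x : V → K) : (laplacianAt G x).IsSymm := by
  classical exact (Matrix.isSymm_diagonal x).sub (G.isSymm_adjMatrix)

theorem laplacianAt_comp_embedding {H : SimpleGraph W} (f : H ↪g G) (x : V → K) :
    laplacianAt H (x ∘ f) = (laplacianAt G x).submatrix f f := by
  ext u w
  rw [Matrix.submatrix_apply]
  by_cases huw : u = w
  · rw [huw, laplacianAt_self, laplacianAt_self, Function.comp_apply]
  · exact laplacianAt_apply_eq_of_adj_iff huw (f.injective.ne huw) f.map_adj_iff.symm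

end Entries

variable {P : Type*} [CommRing P]

theorem map_generalizedLaplacian [CommRing K] [Algebra P K] (x : V → K) :
    (generalizedLaplacian P G).map (MvPolynomial.aeval x) = laplacianAt G x := by
  ext u w
  by_cases huw : u = w
  · simp [generalizedLaplacian, huw, laplacianAt_self]
  · by_cases h : G.Adj u w
    · simp [generalizedLaplacian, huw, h, laplacianAt_of_adj h]
    · simp [generalizedLaplacian, huw, h, laplacianAt_of_not_adj huw h]

theorem aeval_det_submatrix_generalizedLaplacian [CommRing K] [Algebra P K] (x : V → K) {i : ℕ}
    (r c : Fin i → V) :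
    MvPolynomial.aeval x ((generalizedLaplacian P G).submatrix r c).det =
      ((laplacianAt G x).submatrix r c).det := by
  rw [AlgHom.map_det, ← map_generalizedLaplacian (P := P)]
  rfl

theorem criticalIdeal_le_ker_aeval_iff [Field K] [Algebra P K] [Fintype V] {x : V → K} {i : ℕ} :
    criticalIdeal P G i ≤ RingHom.ker (MvPolynomial.aeval (R := P) x) ↔
      (laplacianAt G x).rank < i := by
  rw [← not_le, le_rank_iff_exists_det_submatrix_ne_zero, criticalIdeal, Ideal.span_le,
    Set.range_subset_iff]
  simp [aeval_det_submatrix_generalizedLaplacian]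

end Laplacian

section Corank

theorem algebraicCorank_le_rank_laplacianAt {P K V : Type*} [CommRing P] [Nontrivial P] [Field K]
    [Algebra P K] [Fintype V] (G : SimpleGraph V) (x : V → K) :
    algebraicCorank P G ≤ (laplacianAt G x).rank := by
  have htop : criticalIdeal P G (algebraicCorank P G) = ⊤ := (isGreatest_algebraicCorank P G).1
  by_contra! hlt
  have hle := criticalIdeal_le_ker_aeval_iff (P := P).2 hlt
  rw [htop, top_le_iff] at hle
  exact RingHom.ker_ne_top _ hle

universe u v

theorem exists_rank_laplacianAt_eq_algebraicCorank (P : Type u) [CommRing P] [Nontrivial P]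
    {V : Type v} [Fintype V] (G : SimpleGraph V) :
    ∃ (K : Type (max u v)) (_ : Field K) (_ : Algebra P K) (x : V → K),
      (laplacianAt G x).rank = algebraicCorank P G := by
  have hne : criticalIdeal P G (algebraicCorank P G + 1) ≠ ⊤ := fun htop =>
    (isGreatest_algebraicCorank P G).2 htop |>.not_gt (Nat.lt_succ_self _)
  obtain ⟨I, hI, hle⟩ := Ideal.exists_le_maximal _ hne
  let φ : MvPolynomial V P →ₐ[P] I.ResidueField := IsScalarTower.toAlgHom P _ _
  refine ⟨I.ResidueField, inferInstance, inferInstance, φ ∘ MvPolynomial.X,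
    le_antisymm (Nat.lt_succ_iff.1 (criticalIdeal_le_ker_aeval_iff (P := P).1 ?_))
      (algebraicCorank_le_rank_laplacianAt G _)⟩
  have hφ : MvPolynomial.aeval (φ ∘ MvPolynomial.X) = φ := (MvPolynomial.aeval_unique φ).symm
  have hker : RingHom.ker φ = I := I.ker_algebraMap_residueField
  rwa [hφ, hker]

theorem algebraicCorank_le_of_isIndContained {P V W : Type*} [CommRing P] [Nontrivial P] [Finite V]
    [Finite W] {H : SimpleGraph V} {G : SimpleGraph W} (hHG : H ⊴ G) :
    algebraicCorank P H ≤ algebraicCorank P G := by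
  cases nonempty_fintype V
  cases nonempty_fintype W
  obtain ⟨f⟩ := hHG
  obtain ⟨K, _, _, x, hx⟩ := exists_rank_laplacianAt_eq_algebraicCorank P G
  calc algebraicCorank P H ≤ (laplacianAt H (x ∘ f)).rank := algebraicCorank_le_rank_laplacianAt H _
    _ = ((laplacianAt G x).submatrix f f).rank := by rw [laplacianAt_comp_embedding]
    _ ≤ (laplacianAt G x).rank := Matrix.rank_submatrix_le _ _ _
    _ = algebraicCorank P G := hx

end Corank

section TwinMaps

/-- `q : W → V` exhibits `C` as a twin extension of `G` of sign pattern `δ`: the fibre of `v` is a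
clique of twins if `δ v = -1`, an independent set of twins if `δ v = 1`, and has at most one element
if `δ v = 0`. No surjectivity is required, so that `C` may omit some vertices of `G`. -/
structure IsTwinMap {V W : Type*} (G : SimpleGraph V) (δ : V → SignType) (C : SimpleGraph W)
    (q : W → V) : Prop where
  adj_iff : ∀ u w, C.Adj u w ↔ G.Adj (q u) (q w) ∨ (q u = q w ∧ u ≠ w ∧ δ (q u) = -1)
  eq_of_sign_eq_zero : ∀ {u w}, q u = q w → δ (q u) = 0 → u = w

/-- A graph is twin-free if any two distinct vertices are distinguished by the adjacency to a third
one. -/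
def IsTwinFree {V : Type*} (H : SimpleGraph V) : Prop :=
  ∀ i j, i ≠ j → ∃ l, l ≠ i ∧ l ≠ j ∧ ¬ (H.Adj i l ↔ H.Adj j l)

/-- A point `y` is compatible with `δ` if `y v` is the diagonal entry for which the vertices of a
fibre of sign `δ v` have equal rows: `0` for nonadjacent twins and `-1` for adjacent ones. -/
structure IsTwinPoint {K V : Type*} [Ring K] (δ : V → SignType) (y : V → K) : Prop where
  eq_zero : ∀ {v}, δ v = 1 → y v = 0
  eq_neg_one : ∀ {v}, δ v = -1 → y v = -1

variable {V W : Type*} {G : SimpleGraph V} {δ : V → SignType} {C : SimpleGraph W} {q : W → V}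

theorem isTwinMap_twinGraph (G : SimpleGraph V) {d : V → ℤ}
    (hd : ∀ v, SignType.sign (d v) = δ v) : IsTwinMap G δ (twinGraph G d) Sigma.fst where
  adj_iff a b := by
    rw [← hd, sign_eq_neg_one_iff]
    rfl
  eq_of_sign_eq_zero := by
    rintro ⟨v, i⟩ ⟨_, j⟩ rfl h0
    have : Subsingleton (Fin ((d v).natAbs + 1)) := by
      rw [sign_eq_zero_iff.1 ((hd v).trans h0)]
      exact inferInstanceAs (Subsingleton (Fin 1))
    rw [Subsingleton.elim i j]

theorem IsTwinMap.memTwinFamilyStar [Finite W] (h : IsTwinMap G δ C q) :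
    MemTwinFamilyStar G δ C := by
  let N := Nat.card W
  let d : V → ℤ := fun v => δ v * (N + 1 : ℕ)
  have hd : ∀ v, SignType.sign (d v) = δ v := fun v => by
    have hN : SignType.sign ((N + 1 : ℕ) : ℤ) = 1 := sign_pos (by positivity)
    rw [sign_mul, hN, mul_one]
    cases δ v <;> rfl
  have hcopies : ∀ w, δ (q w) ≠ 0 → (d (q w)).natAbs = N + 1 := fun w h0 => by
    simp only [d, Int.natAbs_mul, Int.natAbs_natCast]
    cases hδ : δ (q w) <;> simp_all
  let e := Finite.equivFin W
  let f : W → Σ v, Fin ((d v).natAbs + 1) := fun w => ⟨q w, Fin.ofNat _ (e w)⟩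
  have hf : Function.Injective f := by
    intro u w huw
    have hq : q u = q w := congrArg Sigma.fst huw
    by_cases h0 : δ (q u) = 0
    · exact h.eq_of_sign_eq_zero hq h0
    have hmod := congrArg (fun a => (a.2 : ℕ)) huw
    simp only [f, Fin.val_ofNat, hcopies u h0, hcopies w (hq ▸ h0)] at hmod
    rw [Nat.mod_eq_of_lt (by omega), Nat.mod_eq_of_lt (by omega)] at hmod
    exact e.injective (Fin.ext hmod)
  refine ⟨d, hd, ⟨⟨f, hf⟩, fun {u w} => ?_⟩⟩
  rw [h.adj_iff, ← hf.ne_iff]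
  exact (isTwinMap_twinGraph G hd).adj_iff (f u) (f w)

theorem IsTwinMap.adj_iff_adj_of_eq (h : IsTwinMap G δ C q) {u w z : W} (hq : q u = q w)
    (huz : u ≠ z) (hwz : w ≠ z) : C.Adj u z ↔ C.Adj w z := by
  simp only [h.adj_iff, hq, ne_eq, huz, hwz]

theorem IsTwinMap.isIndContained_of_isTwinFree {U : Type*} {H : SimpleGraph U}
    (h : IsTwinMap G δ C q) (hH : IsTwinFree H) (hHC : H ⊴ C) : H ⊴ G := by
  obtain ⟨f⟩ := hHC
  have hinj : Function.Injective (q ∘ f) := by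
    intro i j hij
    by_contra hne
    obtain ⟨l, hli, hlj, hl⟩ := hH i j hne
    refine hl ?_
    rw [← f.map_adj_iff, ← f.map_adj_iff]
    exact h.adj_iff_adj_of_eq hij (f.injective.ne hli.symm) (f.injective.ne hlj.symm)
  refine ⟨⟨⟨q ∘ f, hinj⟩, fun {i j} => ?_⟩⟩
  rw [← f.map_adj_iff, h.adj_iff]
  exact (or_iff_left fun ⟨hq, hne, _⟩ => hne (congrArg f (hinj hq))).symm

theorem isTwinFree_pathGraph_four : IsTwinFree (SimpleGraph.pathGraph 4) := by
  simp only [IsTwinFree, SimpleGraph.pathGraph_adj]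
  decide

theorem IsTwinMap.isCograph (h : IsTwinMap G δ C q) (hG : IsCograph G) : IsCograph C :=
  fun hP => hG (h.isIndContained_of_isTwinFree isTwinFree_pathGraph_four hP)

theorem IsCograph.of_isIndContained (hG : IsCograph G) (hCG : C ⊴ G) : IsCograph C :=
  fun hP => hG (hP.trans hCG)

theorem IsTwinMap.laplacianAt_comp {K : Type*} [Ring K] {y : V → K} (h : IsTwinMap G δ C q)
    (hy : IsTwinPoint δ y) : laplacianAt C (y ∘ q) = (laplacianAt G y).submatrix q q := by
  ext u w
  rw [Matrix.submatrix_apply]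
  by_cases huw : u = w
  · rw [huw, laplacianAt_self, laplacianAt_self, Function.comp_apply]
  by_cases hq : q u = q w
  · rw [← hq, laplacianAt_self]
    cases hδ : δ (q u) with
    | zero => exact absurd (h.eq_of_sign_eq_zero hq hδ) huw
    | neg =>
      rw [hy.eq_neg_one hδ, laplacianAt_of_adj ((h.adj_iff u w).2 (.inr ⟨hq, huw, hδ⟩))]
    | pos =>
      have hnadj : ¬ C.Adj u w := by
        rw [h.adj_iff]
        rintro (hG | ⟨-, -, hneg⟩)
        · exact hG.ne hq
        · exact absurd (hδ.symm.trans hneg) (by decide)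
      rw [hy.eq_zero hδ, laplacianAt_of_not_adj huw hnadj]
  · have hadj : C.Adj u w ↔ G.Adj (q u) (q w) := by simp [h.adj_iff, hq]
    exact laplacianAt_apply_eq_of_adj_iff huw hq hadj

theorem IsTwinMap.algebraicCorank_le_rank {P K : Type*} [CommRing P] [Nontrivial P] [Field K]
    [Algebra P K] [Fintype V] [Finite W] {y : V → K} (h : IsTwinMap G δ C q)
    (hy : IsTwinPoint δ y) : algebraicCorank P C ≤ (laplacianAt G y).rank := by
  cases nonempty_fintype W
  calc algebraicCorank P C ≤ (laplacianAt C (y ∘ q)).rank := algebraicCorank_le_rank_laplacianAt C _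
    _ = ((laplacianAt G y).submatrix q q).rank := by rw [h.laplacianAt_comp hy]
    _ ≤ (laplacianAt G y).rank := Matrix.rank_submatrix_le _ _ _

end TwinMaps

section RowClasses

open scoped Classical in
/-- The sign pattern of the partition of the vertices into the fibres of `q`, where `y v` is the
common diagonal entry on the fibre of `v`: `0` for a fibre with at most one element, and otherwise
`1` or `-1` according to whether the entry is `0` (nonadjacent twins) or not (adjacent twins). -/
noncomputable def fiberSign {K V W : Type*} [Zero K] (q : W → V) (y : V → K) (v : V) : SignType :=
  if (q ⁻¹' {v}).Subsingleton then 0 else if y v = 0 then 1 else -1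

variable {K V W : Type*} {q : W → V}

theorem fiberSign_eq_zero_iff [Zero K] {y : V → K} {v : V} :
    fiberSign q y v = 0 ↔ (q ⁻¹' {v}).Subsingleton := by
  unfold fiberSign
  split_ifs <;> simp_all

theorem fiberSign_eq_one_iff [Zero K] {y : V → K} {v : V} :
    fiberSign q y v = 1 ↔ ¬ (q ⁻¹' {v}).Subsingleton ∧ y v = 0 := by
  unfold fiberSign
  split_ifs <;> simp_all

theorem fiberSign_eq_neg_one_iff [Zero K] {y : V → K} {v : V} :
    fiberSign q y v = -1 ↔ ¬ (q ⁻¹' {v}).Subsingleton ∧ y v ≠ 0 := by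
  unfold fiberSign
  split_ifs <;> simp_all

variable [Ring K] {C : SimpleGraph W} {x : W → K} {s : V → W}

theorem isTwinPoint_fiberSign
    (hrow : ∀ u, (laplacianAt C x).row (s (q u)) = (laplacianAt C x).row u) :
    IsTwinPoint (fiberSign q (x ∘ s)) (x ∘ s) where
  eq_zero hv := (fiberSign_eq_one_iff.1 hv).2
  eq_neg_one hv := by
    obtain ⟨hfiber, hne⟩ := fiberSign_eq_neg_one_iff.1 hv
    obtain ⟨u, rfl, w, hw, huw⟩ := Set.not_subsingleton_iff.1 hfiber
    have hdiag : laplacianAt C x u w = x (s (q u)) := by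
      rw [← apply_apply_eq_of_row_eq (isSymm_laplacianAt C x) hrow u w, hw, laplacianAt_self]
    rw [Function.comp_apply, ← hdiag] at hne ⊢
    exact (laplacianAt_eq_zero_or_eq_neg_one huw).resolve_left hne

theorem isTwinMap_fiberSign [Nontrivial K] (hqs : Function.LeftInverse q s)
    (hrow : ∀ u, (laplacianAt C x).row (s (q u)) = (laplacianAt C x).row u) :
    IsTwinMap (C.comap s) (fiberSign q (x ∘ s)) C q where
  eq_of_sign_eq_zero hq h0 := fiberSign_eq_zero_iff.1 h0 rfl hq.symm
  adj_iff u w := by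
    by_cases huw : u = w
    · simp [huw]
    have hentry : laplacianAt C x (s (q u)) (s (q w)) = laplacianAt C x u w :=
      apply_apply_eq_of_row_eq (isSymm_laplacianAt C x) hrow u w
    by_cases hq : q u = q w
    · have hfiber : ¬ (q ⁻¹' {q u}).Subsingleton := fun h => huw (h rfl hq.symm)
      have hsign : C.Adj u w ↔ fiberSign q (x ∘ s) (q u) = -1 := by
        rw [← laplacianAt_eq_neg_one_iff C x huw, ← hentry, ← hq, laplacianAt_self]
        refine ⟨fun h => fiberSign_eq_neg_one_iff.2 ⟨hfiber, ?_⟩,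
          (isTwinPoint_fiberSign hrow).eq_neg_one⟩
        simp [h]
      simp [hsign, hq, huw]
    · have hadj : C.Adj u w ↔ C.Adj (s (q u)) (s (q w)) := by
        rw [← laplacianAt_eq_neg_one_iff C x huw, ← hentry,
          laplacianAt_eq_neg_one_iff C x (hqs.injective.ne hq)]
      simp [hq, hadj]

end RowClasses

theorem exists_twinPair_of_algebraicCorank (P : Type*) [CommRing P] [Nontrivial P] {W : Type*}
    [Finite W] (C : SimpleGraph W) :
    ∃ n ≤ algebraicCorank P C + 2 ^ algebraicCorank P C,
      ∃ (G : SimpleGraph (Fin n)) (δ : Fin n → SignType) (q : W → Fin n), G ⊴ C ∧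
        IsTwinMap G δ C q ∧ ∀ d : Fin n → ℤ, (∀ v, SignType.sign (d v) = δ v) →
          algebraicCorank P (twinGraph G d) ≤ algebraicCorank P C := by
  classical
  cases nonempty_fintype W
  obtain ⟨K, _, _, x, hx⟩ := exists_rank_laplacianAt_eq_algebraicCorank P C
  have hbound := ncard_range_row_le (laplacianAt C x) {0, -1} fun u w huw => by
    simpa using laplacianAt_eq_zero_or_eq_neg_one huw
  obtain ⟨q, s, hqs, hrow⟩ :=
    exists_leftInverse_fin_ncard_range (laplacianAt C x).row (Set.toFinite _)
  let f : C.comap s ↪g C := .comap ⟨s, hqs.injective⟩ C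
  have hrank : (laplacianAt (C.comap s) (x ∘ s)).rank ≤ algebraicCorank P C := by
    rw [← hx, show x ∘ s = x ∘ f from rfl, laplacianAt_comp_embedding]
    exact Matrix.rank_submatrix_le _ _ _
  refine ⟨_, ?_, C.comap s, fiberSign q (x ∘ s), q, ⟨f⟩, isTwinMap_fiberSign hqs hrow,
    fun d hd => ?_⟩
  · rw [← hx]
    exact hbound.trans (Nat.add_le_add_left (Nat.pow_le_pow_left Finset.card_le_two _) _)
  · exact ((isTwinMap_twinGraph _ hd).algebraicCorank_le_rank (isTwinPoint_fiberSign hrow)).trans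
      hrank

theorem finite_setOf_sigma_fst_le {α : ℕ → Type*} [∀ n, Finite (α n)] (N : ℕ) :
    {p : Σ n, α n | p.1 ≤ N}.Finite :=
  (Set.finite_range fun a : Σ n : Fin (N + 1), α n => (⟨a.1, a.2⟩ : Σ n, α n)).subset
    fun p hp => ⟨⟨⟨p.1, Nat.lt_succ_of_le hp⟩, p.2⟩, rfl⟩

theorem mainTheorem7_general (P : Type*) [CommRing P] [Nontrivial P] (k : ℕ) :
    ∃ 𝒢 : Set (Σ n : ℕ, SimpleGraph (Fin n) × (Fin n → SignType)), 𝒢.Finite ∧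
      ∀ (W : Type*) [Finite W] (C : SimpleGraph W),
        (IsCograph C ∧ algebraicCorank P C ≤ k) ↔
          ∃ p ∈ 𝒢, MemTwinFamilyStar p.2.1 p.2.2 C := by
  refine ⟨{p | p.1 ≤ k + 2 ^ k ∧ ∀ d : Fin p.1 → ℤ, (∀ v, SignType.sign (d v) = p.2.2 v) →
    IsCograph (twinGraph p.2.1 d) ∧ algebraicCorank P (twinGraph p.2.1 d) ≤ k},
    (finite_setOf_sigma_fst_le _).subset fun p hp => hp.1, fun W _ C => ⟨?_, ?_⟩⟩
  · rintro ⟨hcograph, hcorank⟩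
    obtain ⟨n, hn, G, δ, q, hGC, hq, hle⟩ := exists_twinPair_of_algebraicCorank P C
    have hG : IsCograph G := hcograph.of_isIndContained hGC
    have hnk : n ≤ k + 2 ^ k :=
      hn.trans (add_le_add hcorank (Nat.pow_le_pow_right two_pos hcorank))
    exact ⟨⟨n, G, δ⟩, ⟨hnk, fun d hd =>
      ⟨(isTwinMap_twinGraph G hd).isCograph hG, (hle d hd).trans hcorank⟩⟩, hq.memTwinFamilyStar⟩
  · rintro ⟨p, ⟨-, hp⟩, d, hd, hC⟩
    exact ⟨(hp d hd).1.of_isIndContained hC,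
      (algebraicCorank_le_of_isIndContained hC).trans (hp d hd).2⟩

theorem mainTheorem7 (P : Type*) [CommRing P] [IsDomain P] [IsPrincipalIdealRing P]
    (k : ℕ) (hk : 1 ≤ k) :
    ∃ 𝒢 : Set (Σ n : ℕ, SimpleGraph (Fin n) × (Fin n → SignType)), 𝒢.Finite ∧
      ∀ (W : Type*) [Finite W] (C : SimpleGraph W),
        (C.Connected →
          ((IsCograph C ∧ algebraicCorank P C ≤ k) ↔
            ∃ p ∈ 𝒢, MemTwinFamilyStar p.2.1 p.2.2 C)) ∧
        ((∃ p ∈ 𝒢, MemTwinFamilyStar p.2.1 p.2.2 C) →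
          IsCograph C ∧ algebraicCorank P C ≤ k) :=
  let ⟨𝒢, hfin, h⟩ := mainTheorem7_general P k
  ⟨𝒢, hfin, fun W _ C => ⟨fun _ => h W C, (h W C).2⟩⟩
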